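/- Let $n\ge 1$, and let $w_1,\dots,w_n,z_1,\dots,z_n$ be $2n$ distinct points of the sphere $S^2$. Write $\{\mathbf w,\mathbf z\}$ for the set of these points. Let $\beta_1,\dots,\beta_{n-1}$ be pairwise disjoint closed embedded curves in $S^2\setminus\{\mathbf w,\mathbf z\}$, and let $\alpha_1,\dots,\alpha_{n-1}$ be pairwise disjoint closed embedded curves in $S^2\setminus\{\mathbf w,\mathbf z\}$ (an $\alpha$-curve may meet a $\beta$-curve). Suppose that for each $1\le i\le n-1$ the curve $\beta_i$ encircles exactly the basepoints $w_i,z_i$, i.e. $w_i$ and $z_i$ lie in one component of $S^2\setminus\beta_i$ and all the other basepoints lie in the other component; and that likewise $\alpha_i$ encircles exactly the basepoints $z_i,w_{i+1}$. (Such data arise from the Heegaard diagram on $S^2$ given by an $n$-bridge presentation of a knot in $S^3$.) For a space $X$ let $\mathrm{Sym}^{n-1}(X)$ be the quotient of $X^{n-1}$ by permutations of the factors, and let $\mathbb T_{\boldsymbol\alpha}=\alpha_1\times\cdots\times\alpha_{n-1}$ and $\mathbb T_{\boldsymbol\beta}=\beta_1\times\cdots\times\beta_{n-1}$, regarded as subspaces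 of $\mathrm{Sym}^{n-1}(S^2\setminus\{\mathbf w,\mathbf z\})$. Let $$i_1\colon(\mathbb T_{\boldsymbol\beta}\times\{0\})\cup(\mathbb T_{\boldsymbol\alpha}\times\{1\})\to \mathrm{Sym}^{n-1}(S^2\setminus\{\mathbf w,\mathbf z\})\times[0,1]$$ be the inclusion. Then for every $k\ge 1$ the pullback on integral singular cohomology $$i_1^*\colon H^k\big(\mathrm{Sym}^{n-1}(S^2\setminus\{\mathbf w,\mathbf z\})\times[0,1];\mathbb Z\big)\to H^k\big((\mathbb T_{\boldsymbol\beta}\times\{0\})\cup(\mathbb T_{\boldsymbol\alpha}\times\{1\});\mathbb Z\big)$$ is surjective. -/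

import Mathlib

open CategoryTheory

noncomputable section

namespace BridgeDiagram

/-- Integral singular cohomology in degree `k`: the degree `k` cohomology of the cochain complex
`Hom(C_•(X), ℤ)`, where `C_•(X)` is the integral singular chain complex of `X`. -/
def cohomologyFunctor (k : ℕ) : TopCat.{0}ᵒᵖ ⥤ AddCommGrpCat.{0} :=
  ((AlgebraicTopology.singularChainComplexFunctor AddCommGrpCat.{0}).obj
      (AddCommGrpCat.of ℤ)).op ⋙
    HomologicalComplex.opFunctor AddCommGrpCat.{0} (ComplexShape.down ℕ) ⋙
    (preadditiveYoneda.obj (AddCommGrpCat.of ℤ)).mapHomologicalComplex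
      (ComplexShape.down ℕ).symm ⋙
    HomologicalComplex.homologyFunctor AddCommGrpCat.{0} (ComplexShape.down ℕ).symm k

/-- The group `H^k(X; ℤ)`. -/
abbrev Cohomology (k : ℕ) (X : Type) [TopologicalSpace X] : Type :=
  (cohomologyFunctor k).obj (Opposite.op (TopCat.of X))

/-- The pullback `f^* : H^k(Y; ℤ) → H^k(X; ℤ)` along a continuous map `f : X → Y`. -/
def cohomologyPullback (k : ℕ) {X Y : Type} [TopologicalSpace X] [TopologicalSpace Y]
    (f : C(X, Y)) : Cohomology k Y →+ Cohomology k X :=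
  ((cohomologyFunctor k).map (TopCat.ofHom f).op).hom

/-- Two `m`-tuples are equivalent if they differ by a permutation of the entries. -/
def permSetoid (X : Type) (m : ℕ) : Setoid (Fin m → X) where
  r x y := ∃ σ : Equiv.Perm (Fin m), x ∘ σ = y
  iseqv :=
    { refl := fun _ => ⟨1, rfl⟩
      symm := by
        rintro x _ ⟨σ, rfl⟩
        exact ⟨σ⁻¹, by ext i; simp⟩
      trans := by
        rintro x _ _ ⟨σ, rfl⟩ ⟨τ, rfl⟩
        exact ⟨σ * τ, rfl⟩ }

/-- The symmetric product `Sym^m(X)`: unordered `m`-tuples of points of `X`. -/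
def SymProd (X : Type) (m : ℕ) : Type := Quotient (permSetoid X m)

/-- The symmetric product carries the quotient topology from `X^m`. -/
instance (X : Type) (m : ℕ) [TopologicalSpace X] : TopologicalSpace (SymProd X m) :=
  inferInstanceAs (TopologicalSpace (Quotient (permSetoid X m)))

/-- The unordered tuple underlying an ordered one. -/
def SymProd.mk {X : Type} {m : ℕ} (x : Fin m → X) : SymProd X m :=
  Quotient.mk (permSetoid X m) x

/-- The sphere `S^2`. -/
abbrev Sphere : Type := Metric.sphere (0 : EuclideanSpace ℝ (Fin 3)) 1

/-- `A` lies in one connected component of the complement of `J`, and `B` lies in a different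
one. -/
def Separates (J A B : Set Sphere) : Prop :=
  A ⊆ Jᶜ ∧ B ⊆ Jᶜ ∧
  (∀ x ∈ A, ∀ y ∈ A, connectedComponentIn Jᶜ x = connectedComponentIn Jᶜ y) ∧
  (∀ x ∈ B, ∀ y ∈ B, connectedComponentIn Jᶜ x = connectedComponentIn Jᶜ y) ∧
  (∀ x ∈ A, ∀ y ∈ B, connectedComponentIn Jᶜ x ≠ connectedComponentIn Jᶜ y)

end BridgeDiagram

open BridgeDiagram in
/-- A Heegaard diagram on `S^2` of the kind given by an `n`-bridge presentation of a knot, where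
`n = m + 1`. The indices are shifted by one: `w i` and `z i` for `0 ≤ i ≤ m` stand for
`w_{i+1}` and `z_{i+1}`, the basepoints in the order met along the knot, and `α i` and `β i`
for `0 ≤ i < m` stand for `α_{i+1}` and `β_{i+1}`. -/
structure BridgeDiagram (m : ℕ) where
  w : Fin (m + 1) → Sphere
  z : Fin (m + 1) → Sphere
  basepoints_injective : Function.Injective (Sum.elim w z)
  α : Fin m → C(Circle, Sphere)
  β : Fin m → C(Circle, Sphere)
  α_injective : ∀ i, Function.Injective (α i)
  β_injective : ∀ i, Function.Injective (β i)
  α_disjoint : ∀ i j, i ≠ j → Disjoint (Set.range (α i)) (Set.range (α j))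
  β_disjoint : ∀ i j, i ≠ j → Disjoint (Set.range (β i)) (Set.range (β j))
  /-- `β i` encircles the basepoints `w i`, `z i` and no others. -/
  β_encircles : ∀ i : Fin m,
    Separates (Set.range (β i)) {w i.castSucc, z i.castSucc}
      ((Set.range w ∪ Set.range z) \ {w i.castSucc, z i.castSucc})
  /-- `α i` encircles the basepoints `z i`, `w (i + 1)` and no others. -/
  α_encircles : ∀ i : Fin m,
    Separates (Set.range (α i)) {z i.castSucc, w i.succ}
      ((Set.range w ∪ Set.range z) \ {z i.castSucc, w i.succ})

namespace BridgeDiagram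

variable {m : ℕ} (D : BridgeDiagram m)

/-- The punctured sphere `S^2 ∖ {w, z}`. -/
abbrev PuncturedSphere : Type := {x : Sphere // x ∉ Set.range D.w ∪ Set.range D.z}

/-- The image in `Sym^m(S^2 ∖ {w, z})` of the product of the `m` curves `γ i`. -/
def torus (γ : Fin m → C(Circle, Sphere)) : Set (SymProd D.PuncturedSphere m) :=
  {q | ∃ x : Fin m → D.PuncturedSphere, (∀ i, (x i : Sphere) ∈ Set.range (γ i)) ∧ SymProd.mk x = q}

/-- The subspace `(T_β × {0}) ∪ (T_α × {1})` of `Sym^m(S^2 ∖ {w, z}) × [0, 1]`. -/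
def ends : Set (SymProd D.PuncturedSphere m × unitInterval) :=
  (D.torus D.β ×ˢ {0}) ∪ (D.torus D.α ×ˢ {1})

/-- The inclusion of `(T_β × {0}) ∪ (T_α × {1})`. -/
def endsInclusion : C(D.ends, SymProd D.PuncturedSphere m × unitInterval) :=
  ⟨Subtype.val, continuous_subtype_val⟩

end BridgeDiagram

end

/-!
The two pieces `T_β × {0}` and `T_α × {1}` are disjoint, so it suffices to extend every class on one
torus over the symmetric product so that the extension vanishes on the other torus.

For this it is enough to have circle-valued functions `u i` on the punctured sphere with degree
`δ i j` on `β j` and degree `0` on every `α j`. Then `[x] ↦ (∏ j, u i (x j))_i` is a map from the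
symmetric product to the standard torus. Restricted to `T_β`, which is parametrized by the
standard torus, it is homotopic to the inverse of the parametrization; restricted to `T_α` it is
null-homotopic. Pulling back along it thus extends every class of positive degree on `T_β` by a
class that vanishes on `T_α` (`exists_extension`), and the roles of `α` and `β` can be exchanged.
The cohomology of the torus is never computed: homotopy invariance, the vanishing of the positive
cohomology of a point, and additivity for disjoint unions are all that is used.

The functions `u i` are the phases of rational functions `∏ (z - p) ^ a p` in a stereographic
coordinate that sends the last basepoint to infinity. On a curve around the basepoints `p` and `q`
such a function has degree `±(a p + a q)`, and because the basepoints enclosed by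
`β 0, α 0, β 1, α 1, …` form a chain `w 0, z 0, w 1, z 1, …`, the weights can be chosen so as to
give any degrees on all the curves (`exists_degrees`).

The fact about plane topology needed here is that the winding number of a Jordan curve is constant
`±1` on a component of the complement that is bounded, and zero on the unbounded one. It is proved
with continuous logarithms. A winding number zero about `p` forces the component of `p` to be
unbounded by Borsuk's extension argument (`unbounded_of_hasLog`). If the winding number `d` of `g`
about `p` had `|d| ≥ 2`, then a continuous `|d|`-th root `r` of `g - p` would be disjoint from its
rotations by roots of unity; the rotated copy then joins `0` to infinity off `r`, so that `r` has
winding number zero, although its degree is `±1` (`natAbs_winding_le_one`).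
-/

noncomputable section

namespace BridgeDiagram

/-! ### Continuous logarithms -/

/-- `f` has a continuous logarithm; equivalently, `f` is null-homotopic as a map to `ℂ ∖ {0}`. -/
def HasLog {X : Type*} [TopologicalSpace X] (f : X → ℂ) : Prop :=
  ∃ h : C(X, ℂ), ∀ x, f x = Complex.exp (h x)

namespace HasLog

variable {X Y : Type*} [TopologicalSpace X] [TopologicalSpace Y] {f g : X → ℂ}

lemma const {c : ℂ} (hc : c ≠ 0) : HasLog (fun _ : X => c) :=
  ⟨.const X (Complex.log c), fun _ => (Complex.exp_log hc).symm⟩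

lemma mul (hf : HasLog f) (hg : HasLog g) : HasLog (fun x => f x * g x) := by
  obtain ⟨a, ha⟩ := hf
  obtain ⟨b, hb⟩ := hg
  exact ⟨a + b, fun x => by simp [ha, hb, Complex.exp_add]⟩

lemma inv (hf : HasLog f) : HasLog (fun x => (f x)⁻¹) := by
  obtain ⟨a, ha⟩ := hf
  exact ⟨-a, fun x => by simp [ha, Complex.exp_neg]⟩

lemma div (hf : HasLog f) (hg : HasLog g) : HasLog (fun x => f x / g x) := by
  simpa only [div_eq_mul_inv] using hf.mul hg.inv

lemma zpow (hf : HasLog f) (n : ℤ) : HasLog (fun x => f x ^ n) := by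
  obtain ⟨a, ha⟩ := hf
  exact ⟨(n : ℂ) • a, fun x => by simp [ha, Complex.exp_int_mul]⟩

lemma prod {ι : Type*} (s : Finset ι) {F : ι → X → ℂ} (hF : ∀ i ∈ s, HasLog (F i)) :
    HasLog (fun x => ∏ i ∈ s, F i x) := by
  classical
  induction s using Finset.induction_on with
  | empty => simpa using const (X := X) one_ne_zero
  | insert i s his ih =>
    simp only [Finset.prod_insert his]
    exact (hF i (by simp)).mul (ih fun j hj => hF j (by simp [hj]))

lemma comp (hf : HasLog f) {u : Y → X} (hu : Continuous u) : HasLog (fun y => f (u y)) := by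
  obtain ⟨a, ha⟩ := hf
  exact ⟨a.comp ⟨u, hu⟩, fun y => ha _⟩

lemma of_norm_sub_one_lt (hf : Continuous f) (h : ∀ x, ‖f x - 1‖ < 1) : HasLog f := by
  have hs : ∀ x, f x ∈ Complex.slitPlane := fun x => by
    have := Complex.mem_slitPlane_of_norm_lt_one (h x)
    simpa using this
  exact ⟨⟨fun x => Complex.log (f x), hf.clog hs⟩,
    fun x => (Complex.exp_log (Complex.slitPlane_ne_zero (hs x))).symm⟩

/-- A nonvanishing function on a simply connected space has a logarithm. -/
lemma of_simplyConnected [SimplyConnectedSpace X] [LocallyPathConnectedSpace X]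
    (hf : Continuous f) (h0 : ∀ x, f x ≠ 0) : HasLog f := by
  have x₀ : X := Classical.arbitrary X
  obtain ⟨F, ⟨-, hF⟩, -⟩ := Complex.isCoveringMapOn_exp.existsUnique_continuousMap_lifts
    ⟨f, hf⟩ (Complex.exp_log (h0 x₀)) h0
  exact ⟨F, fun x => (congrFun hF x).symm⟩

end HasLog

/-- The identity of the circle is not null-homotopic in `ℂ ∖ {0}`. -/
lemma not_hasLog_circle : ¬ HasLog (fun x : Circle => (x : ℂ)) := by
  rintro ⟨h, hh⟩
  -- `h (exp (i t)) - i t` takes values in `2πi ℤ`, so it is constant; compare `t = 0` and `t = 2π`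
  set u : ℝ → ℂ := fun t => h (Circle.exp t) - t * Complex.I with hu
  have hexp : ∀ t, ∃ n : ℤ, u t = n * (2 * Real.pi * Complex.I) := fun t => by
    rw [← Complex.exp_eq_one_iff, hu]
    simp only [Complex.exp_sub, ← hh, Circle.coe_exp]
    exact div_self (Complex.exp_ne_zero _)
  choose n hn using hexp
  have hpi : (2 * Real.pi * Complex.I) ≠ 0 := Complex.two_pi_I_ne_zero
  have hcont : Continuous fun t => u t / (2 * Real.pi * Complex.I) := by
    simp only [hu]; fun_prop
  have hcont' : Continuous fun t => ((n t : ℤ) : ℝ) := by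
    have := Complex.continuous_re.comp hcont
    convert this using 2 with t
    simp only [Function.comp, hn, mul_div_cancel_right₀ _ hpi]
    simp
  have hnc : Continuous n := Int.isClosedEmbedding_coe_real.isEmbedding.continuous_iff.2 hcont'
  have := PreconnectedSpace.constant (inferInstance : PreconnectedSpace ℝ) hnc
    (x := 0) (y := 2 * Real.pi)
  have h2 : u 0 = u (2 * Real.pi) := by rw [hn, hn, this]
  simp only [hu, Circle.exp_zero, Circle.exp_two_pi] at h2
  push_cast at h2
  exact hpi (by linear_combination h2)

/-- Every map `f : Circle → ℂ ∖ {0}` has a degree `d`, encoded by a logarithm of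
`f x * x ^ (-d)`. -/
lemma exists_degree {f : Circle → ℂ} (hf : Continuous f) (h0 : ∀ x, f x ≠ 0) :
    ∃ d : ℤ, HasLog (fun x : Circle => f x * (x : ℂ) ^ (-d)) := by
  obtain ⟨h, hh⟩ := HasLog.of_simplyConnected (X := ℝ) (f := fun t => f (Circle.exp t))
    (by fun_prop) fun _ => h0 _
  have hexp : ∀ t, ∃ n : ℤ,
      h (t + 2 * Real.pi) - h t = n * (2 * Real.pi * Complex.I) := fun t => by
    rw [← Complex.exp_eq_one_iff, Complex.exp_sub, ← hh, ← hh]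
    simp only [Circle.exp_add_two_pi]
    exact div_self (h0 _)
  choose n hn using hexp
  have hpi : (2 * Real.pi * Complex.I) ≠ 0 := Complex.two_pi_I_ne_zero
  have hcont : Continuous fun t => (h (t + 2 * Real.pi) - h t) / (2 * Real.pi * Complex.I) := by
    fun_prop
  have hcont' : Continuous fun t => ((n t : ℤ) : ℝ) := by
    have := Complex.continuous_re.comp hcont
    convert this using 2 with t
    simp only [Function.comp, hn, mul_div_cancel_right₀ _ hpi]
    simp
  have hnc : Continuous n := Int.isClosedEmbedding_coe_real.isEmbedding.continuous_iff.2 hcont'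
  have hconst : ∀ t, n t = n 0 := fun t =>
    PreconnectedSpace.constant (inferInstance : PreconnectedSpace ℝ) hnc
  -- `h t - i n t` is `2π`-periodic, so it descends to the circle
  let g : ℝ → ℂ := fun t => h t - n 0 * (t * Complex.I)
  have hg : Continuous g := by simp only [g]; fun_prop
  have hper : Function.Periodic g (2 * Real.pi) := fun t => by
    have := hn t
    rw [hconst, sub_eq_iff_eq_add] at this
    simp only [g, this]; push_cast; ring
  let G : AddCircle (2 * Real.pi) → ℂ := hper.lift
  have hG : Continuous G := continuous_coinduced_dom.2 hg
  refine ⟨n 0, ⟨fun x => G (AddCircle.homeomorphCircle'.symm x), by fun_prop⟩, fun x => ?_⟩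
  obtain ⟨t, rfl⟩ : ∃ t : ℝ, x = Circle.exp t := ⟨_, (Circle.exp_arg x).symm⟩
  have h1 : AddCircle.homeomorphCircle'.symm (Circle.exp t) = (t : AddCircle (2 * Real.pi)) := by
    rw [Homeomorph.symm_apply_eq, AddCircle.homeomorphCircle'_apply_mk]
  have h2 : G (t : AddCircle (2 * Real.pi)) = g t := Function.Periodic.lift_coe hper t
  simp only [ContinuousMap.coe_mk, h1, h2, g]
  rw [Complex.exp_sub, ← hh, Complex.exp_int_mul, Circle.coe_exp, div_eq_mul_inv, zpow_neg]

/-! ### Winding numbers of Jordan curves in the plane -/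

section Winding

variable {X : Type*} [TopologicalSpace X] [CompactSpace X] {g : X → ℂ}

/-- The class of `g - p` only depends on the component of the complement that contains `p`. -/
lemma hasLog_sub_div_sub (hg : Continuous g) {S : Set ℂ} (hS : IsPreconnected S)
    (hd : ∀ x, g x ∉ S) {p q : ℂ} (hp : p ∈ S) (hq : q ∈ S) :
    HasLog (fun x => (g x - p) / (g x - q)) := by
  have hne : ∀ x, ∀ a ∈ S, g x - a ≠ 0 := fun x a ha h => hd x (sub_eq_zero.1 h ▸ ha)
  refine hS.induction₂ (fun p q => HasLog (fun x => (g x - p) / (g x - q))) (fun a ha => ?_)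
    (fun a b c ha hb hc h1 h2 => ?_) (fun a b ha hb h => ?_) hp hq
  · have hKc : IsCompact (Set.range g) := isCompact_range hg
    have hnot : a ∉ Set.range g := fun ⟨x, hx⟩ => hd x (hx ▸ ha)
    obtain ⟨ε, hε, hball⟩ := Metric.mem_nhds_iff.1 (hKc.isClosed.isOpen_compl.mem_nhds hnot)
    refine Filter.mem_of_superset (mem_nhdsWithin_of_mem_nhds (Metric.ball_mem_nhds a hε))
      fun b hb => ?_
    have hε' : ∀ x, ε ≤ ‖g x - a‖ := fun x => by
      by_contra! h
      exact hball (by rwa [Metric.mem_ball, dist_eq_norm] : g x ∈ Metric.ball a ε) ⟨x, rfl⟩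
    have hlt : ∀ x, ‖(g x - b) / (g x - a) - 1‖ < 1 := fun x => by
      have h0 := hne x a ha
      rw [div_sub_one h0, norm_div, div_lt_one (norm_pos_iff.2 h0)]
      refine lt_of_lt_of_le ?_ (hε' x)
      rw [Metric.mem_ball, dist_eq_norm] at hb
      rwa [show g x - b - (g x - a) = -(b - a) by ring, norm_neg]
    have := HasLog.of_norm_sub_one_lt
      (((hg.sub continuous_const).div (hg.sub continuous_const)) fun x => hne x a ha) hlt
    simpa using this.inv
  · have := h1.mul h2
    refine (congrArg HasLog (funext fun x => ?_)).mp this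
    have := hne x b hb
    field_simp
  · simpa using h.inv

/-- The winding number of `g` about a point that can be joined to infinity off `g` is zero. -/
lemma hasLog_sub_of_unbounded (hg : Continuous g) {S : Set ℂ} (hS : IsPreconnected S)
    (hd : ∀ x, g x ∉ S) (hu : ∀ R : ℝ, ∃ q ∈ S, R < ‖q‖) {p : ℂ} (hp : p ∈ S) :
    HasLog (fun x => g x - p) := by
  obtain ⟨R, hR⟩ := (isCompact_range hg).isBounded.exists_norm_le
  obtain ⟨q, hq, hqR⟩ := hu (max R 0)
  have hq0 : q ≠ 0 := norm_pos_iff.1 (lt_of_le_of_lt (le_max_right _ _) hqR)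
  have h1 : HasLog (fun x => (g x - q) / (-q)) := by
    refine .of_norm_sub_one_lt (by fun_prop) fun x => ?_
    rw [show (g x - q) / (-q) - 1 = - (g x / q) by field_simp; ring, norm_neg, norm_div,
      div_lt_one (norm_pos_iff.2 hq0)]
    exact lt_of_le_of_lt ((hR _ ⟨x, rfl⟩).trans (le_max_left _ _)) hqR
  have := (hasLog_sub_div_sub hg hS hd hp hq).mul (h1.mul (.const (c := -q) (neg_ne_zero.2 hq0)))
  refine (congrArg HasLog (funext fun x => ?_)).mp this
  have h2 : g x - q ≠ 0 := fun h => hd x (sub_eq_zero.1 h ▸ hq)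
  field_simp

end Winding

/-- If `r` and `ζ r` have disjoint images for some `ζ` on the unit circle, then `r` has winding
number zero about the origin: the image of `ζ r`, together with the radial segments at its
points of least and greatest modulus, joins the origin to infinity off the image of `r`. -/
lemma hasLog_of_disjoint_rotation {X : Type*} [TopologicalSpace X] [CompactSpace X]
    [ConnectedSpace X] {r : X → ℂ} (hr : Continuous r) (h0 : ∀ x, r x ≠ 0) {ζ : ℂ} (hζ : ‖ζ‖ = 1)
    (hdisj : ∀ x y, ζ * r x ≠ r y) : HasLog r := by
  obtain ⟨a, -, ha⟩ := isCompact_univ.exists_isMinOn Set.univ_nonempty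
    (hr.norm.continuousOn (s := Set.univ))
  obtain ⟨b, -, hb⟩ := isCompact_univ.exists_isMaxOn Set.univ_nonempty
    (hr.norm.continuousOn (s := Set.univ))
  have ha' : ∀ x, ‖r a‖ ≤ ‖r x‖ := fun x => ha (Set.mem_univ x)
  have hb' : ∀ x, ‖r x‖ ≤ ‖r b‖ := fun x => hb (Set.mem_univ x)
  let J : Set ℂ := Set.range fun x => ζ * r x
  let A : Set ℂ := (fun t : ℝ => (t : ℂ) * (ζ * r a)) '' Set.Icc 0 1
  let B : Set ℂ := (fun t : ℝ => (t : ℂ) * (ζ * r b)) '' Set.Ici 1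
  have hJ : IsPreconnected J := isPreconnected_range (by fun_prop)
  have hA : IsPreconnected A := isPreconnected_Icc.image _ (by fun_prop)
  have hB : IsPreconnected B := isPreconnected_Ici.image _ (by fun_prop)
  have hS : IsPreconnected (A ∪ J ∪ B) := by
    refine .union (ζ * r b) (.inr ⟨b, rfl⟩) ⟨1, by simp⟩ ?_ hB
    exact .union (ζ * r a) ⟨1, by simp⟩ ⟨a, rfl⟩ hA hJ
  have hmain := hasLog_sub_of_unbounded hr hS (p := 0) ?_ ?_ (.inl (.inl ⟨0, by simp⟩))
  · simpa using hmain
  · rintro x ((⟨t, ⟨ht0, ht1⟩, h⟩ | ⟨y, h⟩) | ⟨t, ht, h⟩)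
    · have hn := congrArg norm h
      simp only [norm_mul, hζ, one_mul, Complex.norm_real, Real.norm_of_nonneg ht0] at hn
      rcases ht1.lt_or_eq with h1 | rfl
      · have := ha' x
        have := norm_pos_iff.2 (h0 a)
        nlinarith
      · exact hdisj a x (by simpa using h)
    · exact hdisj y x h
    · have ht : 1 ≤ t := ht
      have hn := congrArg norm h
      simp only [norm_mul, hζ, one_mul, Complex.norm_real,
        Real.norm_of_nonneg (zero_le_one.trans ht)] at hn
      rcases ht.lt_or_eq with h1 | rfl
      · have := hb' x
        have := norm_pos_iff.2 (h0 b)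
        nlinarith
      · exact hdisj b x (by simpa using h)
  · intro R
    have hbpos := norm_pos_iff.2 (h0 b)
    have ht0 : (0 : ℝ) ≤ 1 + |R| / ‖r b‖ := by positivity
    refine ⟨_, .inr ⟨1 + |R| / ‖r b‖, ?_, rfl⟩, ?_⟩
    · simp only [Set.mem_Ici, le_add_iff_nonneg_right]; positivity
    · rw [norm_mul, norm_mul, hζ, one_mul, Complex.norm_real, Real.norm_of_nonneg ht0, add_mul,
        div_mul_cancel₀ _ hbpos.ne']
      have := le_abs_self R
      linarith

lemma not_hasLog_circle_zpow {d : ℤ} (hd : d = 1 ∨ d = -1) :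
    ¬ HasLog (fun x : Circle => (x : ℂ) ^ d) := by
  intro h
  rcases hd with rfl | rfl
  · exact not_hasLog_circle (by simpa using h)
  · exact not_hasLog_circle (by simpa using h.inv)

/-- The winding number of a Jordan curve about a point is at most one in absolute value. If it were
`d` with `|d| ≥ 2`, then `g - p` would have a `|d|`-th root `r` of degree `±1`; as `g` is
injective, `r` is disjoint from its rotations by the `|d|`-th roots of unity. -/
lemma natAbs_winding_le_one {g : Circle → ℂ} (hinj : Function.Injective g) {p : ℂ}
    {d : ℤ} (hd : HasLog (fun x : Circle => (g x - p) * (x : ℂ) ^ (-d))) : d.natAbs ≤ 1 := by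
  by_contra! h2
  obtain ⟨h, hh⟩ := hd
  have hx0 : ∀ x : Circle, (x : ℂ) ≠ 0 := Circle.coe_ne_zero
  set N := d.natAbs with hN
  have hN0 : (N : ℂ) ≠ 0 := by exact_mod_cast (by omega : N ≠ 0)
  obtain ⟨s, hs, hds⟩ : ∃ s : ℤ, (s = 1 ∨ s = -1) ∧ d = s * N := by
    rcases Int.natAbs_eq d with h | h
    · exact ⟨1, .inl rfl, by omega⟩
    · exact ⟨-1, .inr rfl, by omega⟩
  let r : Circle → ℂ := fun x => (x : ℂ) ^ s * Complex.exp (h x / N)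
  have hrN : ∀ x, r x ^ N = g x - p := fun x => by
    have := hh x
    dsimp only at this
    rw [zpow_neg, mul_inv_eq_iff_eq_mul₀ (zpow_ne_zero _ (hx0 x))] at this
    rw [this, mul_pow, ← Complex.exp_nat_mul, mul_div_cancel₀ _ hN0, mul_comm, hds, zpow_mul,
      zpow_natCast]
  have hr0 : ∀ x, r x ≠ 0 := fun x => mul_ne_zero (zpow_ne_zero _ (hx0 x)) (Complex.exp_ne_zero _)
  have hrc : Continuous r := by
    refine Continuous.mul (Continuous.zpow₀ continuous_subtype_val s fun x => .inl (hx0 x)) ?_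
    fun_prop
  have hζ := Complex.isPrimitiveRoot_exp N (by omega)
  set ζ := Complex.exp (2 * Real.pi * Complex.I / N)
  have hlog : HasLog r := by
    refine hasLog_of_disjoint_rotation hrc hr0 (hζ.norm'_eq_one (by omega)) fun x y hxy => ?_
    have h1 := congrArg (· ^ N) hxy
    simp only [mul_pow, hζ.pow_eq_one, one_mul, hrN, sub_left_inj] at h1
    obtain rfl := hinj h1
    have : ζ = 1 := by simpa [hr0 x] using hxy
    exact hζ.ne_one (by omega) this
  refine not_hasLog_circle_zpow hs ?_
  have h3 := hlog.div (g := fun x => Complex.exp (h x / N))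
    ⟨⟨fun x => h x / N, by fun_prop⟩, fun _ => rfl⟩
  refine (congrArg HasLog (funext fun x => ?_)).mp h3
  simp only [r]
  rw [mul_div_cancel_right₀ _ (Complex.exp_ne_zero _)]

/-- Borsuk's criterion: if `g` is an embedding and `g - p` has a logarithm, then `p` is in an
unbounded component of the complement of `range g`. Otherwise extending the logarithm of
`g - p` over the bounded component `U` of `p` gives a nonvanishing function on the plane that equals
`z - p` outside `U`, and thus on a large circle. -/
lemma unbounded_of_hasLog {X : Type*} [TopologicalSpace X] [CompactSpace X] {g : X → ℂ}
    (hg : Continuous g) (hinj : Function.Injective g) {p : ℂ} (hp : p ∉ Set.range g)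
    (h : HasLog (fun x => g x - p)) (R : ℝ) :
    ∃ q ∈ connectedComponentIn (Set.range g)ᶜ p, R < ‖q‖ := by
  classical
  by_contra! hR
  obtain ⟨l, hl⟩ := h
  set U := connectedComponentIn (Set.range g)ᶜ p with hU
  have hclosed : IsClosed (Set.range g) := (isCompact_range hg).isClosed
  have hUo : IsOpen U := hclosed.isOpen_compl.connectedComponentIn
  obtain ⟨L, hL⟩ := l.exists_extension (hg.isClosedEmbedding hinj)
  have hL' : ∀ x, L (g x) = l x := fun x => DFunLike.congr_fun hL x
  have hfr : ∀ z ∈ frontier U, z ∈ Set.range g := fun z hz => by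
    by_contra hzg
    have hzU : z ∉ U := fun hzU => hUo.inter_frontier_eq.le ⟨hzU, hz⟩
    -- the component of `z` is an open set that meets `U`
    obtain ⟨y, hyz, hyU⟩ := mem_closure_iff.1 (frontier_subset_closure hz) _
      hclosed.isOpen_compl.connectedComponentIn (mem_connectedComponentIn (x := z) hzg)
    rw [connectedComponentIn_eq hyU, ← connectedComponentIn_eq hyz] at hU
    exact hzU (hU ▸ mem_connectedComponentIn (x := z) hzg)
  let F : ℂ → ℂ := fun z => if z ∈ U then Complex.exp (L z) else z - p
  have hF : Continuous F := by
    refine Continuous.if (fun z hz => ?_) (by fun_prop) (by fun_prop)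
    obtain ⟨x, rfl⟩ := hfr z hz
    rw [hL', ← hl]
  have hF0 : ∀ z, F z ≠ 0 := fun z => by
    by_cases hz : z ∈ U
    · simp [F, hz]
    · simp only [F, hz, if_false]
      exact fun h => hz (sub_eq_zero.1 h ▸ mem_connectedComponentIn (x := p) hp)
  have hlog := HasLog.of_simplyConnected hF hF0
  set ρ : ℝ := |R| + ‖p‖ + 1
  have hρ : 0 < ρ := by positivity
  have hρ0 : (ρ : ℂ) ≠ 0 := by exact_mod_cast hρ.ne'
  have h1 := (hlog.comp (u := fun x : Circle => p + ρ * (x : ℂ)) (by fun_prop)).div (.const hρ0)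
  refine not_hasLog_circle ((congrArg HasLog (funext fun x => ?_)).mp h1)
  have hx : p + ρ * (x : ℂ) ∉ U := fun hx => by
    have h2 := hR _ hx
    have h3 : ‖(ρ : ℂ) * x‖ ≤ ‖p + ρ * (x : ℂ)‖ + ‖p‖ := by
      simpa using norm_sub_le (p + ρ * (x : ℂ)) p
    rw [norm_mul, Circle.norm_coe, mul_one, Complex.norm_real, Real.norm_of_nonneg hρ.le] at h3
    have := le_abs_self R
    simp only [ρ] at h3
    linarith
  simp only [F, hx, if_false, add_sub_cancel_left]
  field_simp

/-! ### Winding numbers on the sphere -/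

/-- Stereographic projection from `v`, as a complex coordinate. -/
lemma exists_stereographic_chart (v : Sphere) :
    ∃ e : OpenPartialHomeomorph Sphere ℂ, e.source = {v}ᶜ ∧ e.target = Set.univ := by
  have : Fact (Module.finrank ℝ (EuclideanSpace ℝ (Fin 3)) = 2 + 1) := ⟨by simp⟩
  refine ⟨(stereographic' 2 v).trans
    Complex.orthonormalBasisOneI.repr.symm.toHomeomorph.toOpenPartialHomeomorph, ?_, ?_⟩ <;> simp

section Chart

variable {v : Sphere} {e : OpenPartialHomeomorph Sphere ℂ}

lemma continuous_chart_symm (ht : e.target = Set.univ) : Continuous e.symm := by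
  rw [← continuousOn_univ, ← ht]
  exact e.continuousOn_symm

lemma chart_symm_ne (hs : e.source = {v}ᶜ) (ht : e.target = Set.univ) (q : ℂ) : e.symm q ≠ v := by
  have : e.symm q ∈ e.source := e.map_target (ht ▸ Set.mem_univ q)
  rw [hs] at this
  exact this

lemma chart_left_inv (hs : e.source = {v}ᶜ) {x : Sphere} (hx : x ≠ v) : e.symm (e x) = x :=
  e.left_inv (by rw [hs]; exact hx)

lemma chart_right_inv (ht : e.target = Set.univ) (q : ℂ) : e (e.symm q) = q :=
  e.right_inv (ht ▸ Set.mem_univ q)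

lemma chart_ne (hs : e.source = {v}ᶜ) {x y : Sphere} (hx : x ≠ v) (hy : y ≠ v) (hxy : x ≠ y) :
    e x ≠ e y := fun h => hxy <| by
  rw [← chart_left_inv hs hx, ← chart_left_inv hs hy, h]

/-- Far points of the plane are near the projection centre `v` on the sphere. -/
lemma exists_chart_symm_mem (hs : e.source = {v}ᶜ) (ht : e.target = Set.univ) {W : Set Sphere}
    (hW : IsOpen W) (hv : v ∈ W) : ∃ R : ℝ, ∀ q, R < ‖q‖ → e.symm q ∈ W := by
  have hsub : Wᶜ ⊆ e.source := by
    rw [hs]; exact Set.compl_subset_compl.2 (Set.singleton_subset_iff.2 hv)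
  have hc : IsCompact (e '' Wᶜ) :=
    hW.isClosed_compl.isCompact.image_of_continuousOn (e.continuousOn.mono hsub)
  obtain ⟨R, hR⟩ := hc.isBounded.exists_norm_le
  refine ⟨R, fun q hq => ?_⟩
  by_contra hqW
  exact hq.not_ge (hR q ⟨_, hqW, chart_right_inv ht q⟩)

variable {J : Set Sphere}

/-- The component of a point of the plane is unbounded when the corresponding component on the
sphere contains the projection centre. -/
lemma exists_norm_lt_of_mem_component (hs : e.source = {v}ᶜ) (ht : e.target = Set.univ)
    {b : Sphere} (hb : b ∈ Jᶜ) (hbv : b ≠ v)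
    (hv : v ∈ connectedComponentIn Jᶜ b) (hJ : IsClosed J) (R : ℝ) :
    ∃ q ∈ connectedComponentIn (e.symm ⁻¹' J)ᶜ (e b), R < ‖q‖ := by
  by_contra! hR
  have hψ := continuous_chart_symm ht
  set Γ := e.symm ⁻¹' J
  have hΓo : IsOpen Γᶜ := (hJ.preimage hψ).isOpen_compl
  set V := connectedComponentIn Γᶜ (e b) with hV
  have hbΓ : e b ∈ Γᶜ := by
    simp only [Γ, Set.mem_compl_iff, Set.mem_preimage, chart_left_inv hs hbv]; exact hb
  have hVo : IsOpen V := hΓo.connectedComponentIn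
  have hVc : IsCompact (closure V) :=
    (isBounded_iff_forall_norm_le.2 ⟨R, hR⟩).isCompact_closure
  -- `e.symm '' V` is open, and closed in the complement of `J`
  have hO : IsOpen (e.symm '' V) :=
    e.symm.isOpen_image_of_subset_source hVo (by simp [ht])
  have hC : IsClosed (e.symm '' closure V) := (hVc.image hψ).isClosed
  have hcl : ∀ z ∈ closure V, z ∈ Γᶜ → z ∈ V := fun z hz hzΓ => by
    obtain ⟨y, hyz, hyV⟩ := mem_closure_iff.1 hz _ hΓo.connectedComponentIn
      (mem_connectedComponentIn hzΓ)
    rw [hV, connectedComponentIn_eq hyV, ← connectedComponentIn_eq hyz]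
    exact mem_connectedComponentIn hzΓ
  have hsub : connectedComponentIn Jᶜ b ⊆ e.symm '' V := by
    refine isPreconnected_connectedComponentIn.subset_left_of_subset_union hO hC.isOpen_compl
      ?_ ?_ ⟨b, mem_connectedComponentIn hb, e b, mem_connectedComponentIn hbΓ,
        chart_left_inv hs hbv⟩
    · exact Set.disjoint_compl_right_iff_subset.2 (Set.image_mono subset_closure)
    · intro x hx
      by_cases hxC : x ∈ e.symm '' closure V
      · obtain ⟨z, hz, rfl⟩ := hxC
        have hzJ : e.symm z ∈ Jᶜ := connectedComponentIn_subset _ _ hx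
        exact .inl ⟨z, hcl z hz hzJ, rfl⟩
      · exact .inr hxC
  obtain ⟨q, -, hq⟩ := hsub hv
  exact chart_symm_ne hs ht q hq

/-- The converse of `exists_norm_lt_of_mem_component`. -/
lemma mem_component_of_unbounded (hs : e.source = {v}ᶜ) (ht : e.target = Set.univ)
    {a : Sphere} (ha : a ∈ Jᶜ) (hav : a ≠ v) (hv : v ∈ Jᶜ)
    (hu : ∀ R : ℝ, ∃ q ∈ connectedComponentIn (e.symm ⁻¹' J)ᶜ (e a), R < ‖q‖) :
    v ∈ connectedComponentIn Jᶜ a := by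
  set V := connectedComponentIn (e.symm ⁻¹' J)ᶜ (e a) with hV
  have haV : e a ∈ V := by
    refine mem_connectedComponentIn ?_
    simp only [Set.mem_compl_iff, Set.mem_preimage, chart_left_inv hs hav]; exact ha
  have hc : IsPreconnected (insert v (e.symm '' V)) := by
    refine (isPreconnected_connectedComponentIn.image e.symm
      (continuous_chart_symm ht).continuousOn).subset_closure (Set.subset_insert _ _) ?_
    refine Set.insert_subset (mem_closure_iff.2 fun W hW hvW => ?_) subset_closure
    obtain ⟨R, hR⟩ := exists_chart_symm_mem hs ht hW hvW
    obtain ⟨q, hq, hqR⟩ := hu R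
    exact ⟨_, hR q hqR, q, hq, rfl⟩
  refine hc.subset_connectedComponentIn (.inr ⟨e a, haV, chart_left_inv hs hav⟩) ?_ (.inl rfl)
  refine Set.insert_subset hv ?_
  rintro _ ⟨q, hq, rfl⟩
  have hqJ : q ∈ (e.symm ⁻¹' J)ᶜ := connectedComponentIn_subset _ _ hq
  exact hqJ

/-- In the stereographic coordinate at a point `v` off a Jordan curve, the winding number is a
constant `±1` on a component that does not contain `v`, and zero on the component of `v`. -/
lemma exists_winding (hs : e.source = {v}ᶜ) (ht : e.target = Set.univ) {γ : C(Circle, Sphere)}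
    (hγ : Function.Injective γ) {A B : Set Sphere} (h : Separates (Set.range γ) A B) (hv : v ∈ B) :
    ∃ ε : ℤ, ε * ε = 1 ∧ (∀ a ∈ A, HasLog fun x : Circle => (e (γ x) - e a) * (x : ℂ) ^ (-ε)) ∧
      ∀ b ∈ B, b ≠ v → HasLog fun x : Circle => e (γ x) - e b := by
  obtain ⟨hA, hB, hAA, hBB, hAB⟩ := h
  have hψ := continuous_chart_symm ht
  set J := Set.range γ with hJdef
  have hJ : IsClosed J := (isCompact_range γ.continuous).isClosed
  have hγv : ∀ x, γ x ≠ v := fun x hx => hB hv ⟨x, hx⟩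
  have hg : Continuous fun x => e (γ x) :=
    e.continuousOn.comp_continuous γ.continuous fun x => by rw [hs]; exact hγv x
  have hginj : Function.Injective fun x => e (γ x) := fun x y hxy => hγ <| by
    by_contra hne
    exact chart_ne hs (hγv x) (hγv y) hne hxy
  have hrange : Set.range (fun x => e (γ x)) = e.symm ⁻¹' J := by
    ext q
    constructor
    · rintro ⟨x, rfl⟩
      exact ⟨x, (chart_left_inv hs (hγv x)).symm⟩
    · rintro ⟨x, hx⟩
      exact ⟨x, by simp only [hx, chart_right_inv ht]⟩
  have hAv : ∀ a ∈ A, a ≠ v := fun a ha hav => hAB a ha v hv (by rw [hav])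
  have hvn : ∀ a ∈ A, v ∉ connectedComponentIn Jᶜ a := fun a ha hva =>
    hAB a ha v hv (connectedComponentIn_eq hva)
  have hne : ∀ a ∈ Jᶜ, a ≠ v → ∀ x, e (γ x) - e a ≠ 0 := fun a ha hav x =>
    sub_ne_zero.2 (chart_ne hs (hγv x) hav fun hxa => ha ⟨x, hxa⟩)
  have hBlog : ∀ b ∈ B, b ≠ v → HasLog fun x : Circle => e (γ x) - e b := fun b hb hbv => by
    have hbv' : v ∈ connectedComponentIn Jᶜ b := by
      rw [hBB b hb v hv]; exact mem_connectedComponentIn (hB hv)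
    have hbΓ : e b ∈ (e.symm ⁻¹' J)ᶜ := by
      simp only [Set.mem_compl_iff, Set.mem_preimage, chart_left_inv hs hbv]; exact hB hb
    refine hasLog_sub_of_unbounded hg
      (S := connectedComponentIn (e.symm ⁻¹' J)ᶜ (e b)) isPreconnected_connectedComponentIn
      (fun x hx => connectedComponentIn_subset _ _ hx (hrange ▸ ⟨x, rfl⟩))
      (exists_norm_lt_of_mem_component hs ht (hB hb) hbv hbv' hJ) (mem_connectedComponentIn hbΓ)
  rcases A.eq_empty_or_nonempty with rfl | ⟨a₀, ha₀⟩
  · exact ⟨1, rfl, by simp, hBlog⟩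
  obtain ⟨d, hd⟩ := exists_degree (f := fun x => e (γ x) - e a₀) (hg.sub continuous_const)
    (hne a₀ (hA ha₀) (hAv a₀ ha₀))
  have hd1 := natAbs_winding_le_one hginj hd
  have hd0 : d ≠ 0 := by
    rintro rfl
    refine hvn a₀ ha₀ (mem_component_of_unbounded hs ht (hA ha₀) (hAv a₀ ha₀) (hB hv) ?_)
    rw [← hrange]
    refine unbounded_of_hasLog hg hginj ?_ (by simpa using hd)
    rw [hrange, Set.mem_preimage, chart_left_inv hs (hAv a₀ ha₀)]
    exact hA ha₀
  refine ⟨d, ?_, fun a ha => ?_, hBlog⟩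
  · have : d = 1 ∨ d = -1 := by omega
    rcases this with rfl | rfl <;> rfl
  · have hC : IsPreconnected (e '' connectedComponentIn Jᶜ a₀) :=
      isPreconnected_connectedComponentIn.image e <| e.continuousOn.mono fun x hx => by
        rw [hs]
        rintro rfl
        exact hvn a₀ ha₀ hx
    have hmem : a ∈ connectedComponentIn Jᶜ a₀ := by
      rw [hAA a₀ ha₀ a ha]; exact mem_connectedComponentIn (hA ha)
    have hdisj : ∀ x, e (γ x) ∉ e '' connectedComponentIn Jᶜ a₀ := by
      rintro x ⟨y, hy, hyx⟩
      have hyJ := connectedComponentIn_subset _ _ hy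
      refine chart_ne hs (fun hyv => hvn a₀ ha₀ (hyv ▸ hy)) (hγv x)
        (fun hyx' => hyJ ⟨x, hyx'.symm⟩) hyx
    have := (hasLog_sub_div_sub hg hC hdisj ⟨a, hmem, rfl⟩
      ⟨a₀, mem_connectedComponentIn (hA ha₀), rfl⟩).mul hd
    refine (congrArg HasLog (funext fun x => ?_)).mp this
    rw [← mul_assoc, div_mul_cancel₀ _ (hne a₀ (hA ha₀) (hAv a₀ ha₀) x)]

end Chart

/-! ### Symmetric products -/

section SymProd

variable {X Y : Type} {m : ℕ}

lemma SymProd.mk_eq_mk {x y : Fin m → X} :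
    SymProd.mk x = SymProd.mk y ↔ ∃ σ : Equiv.Perm (Fin m), x ∘ σ = y :=
  Quotient.eq (r := permSetoid X m)

lemma SymProd.mk_surjective : Function.Surjective (SymProd.mk : (Fin m → X) → SymProd X m) :=
  Quotient.mk_surjective

variable [TopologicalSpace X] [TopologicalSpace Y]

lemma SymProd.continuous_mk : Continuous (SymProd.mk : (Fin m → X) → SymProd X m) :=
  continuous_quotient_mk'

/-- The map out of a symmetric product given by a product of values in a commutative monoid. -/
def SymProd.prodMap [CommMonoid Y] [ContinuousMul Y] (f : C(X, Y)) : C(SymProd X m, Y) where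
  toFun := Quotient.lift (s := permSetoid X m) (fun x => ∏ j, f (x j)) <| by
    rintro x _ ⟨σ, rfl⟩
    exact (Equiv.prod_comp σ fun j => f (x j)).symm
  continuous_toFun := Continuous.quotient_lift (s := permSetoid X m) (by fun_prop) _

@[simp]
lemma SymProd.prodMap_mk [CommMonoid Y] [ContinuousMul Y] (f : C(X, Y)) (x : Fin m → X) :
    SymProd.prodMap f (SymProd.mk x) = ∏ j, f (x j) := rfl

/-- Two tuples with the same underlying multiset differ by a permutation. -/
lemma exists_perm_of_map_eq {Z : Type*} {f g : Fin m → Z}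
    (h : Finset.univ.val.map f = Finset.univ.val.map g) :
    ∃ σ : Equiv.Perm (Fin m), f ∘ σ = g := by
  classical
  have hc : ∀ c, Nonempty ({i // g i = c} ≃ {i // f i = c}) := fun c => by
    refine ⟨Fintype.equivOfCardEq ?_⟩
    have h1 := congrArg (Multiset.count c) h
    rw [Multiset.count_map, Multiset.count_map] at h1
    rw [Fintype.card_subtype, Fintype.card_subtype, Finset.card_def, Finset.card_def,
      Finset.filter_val, Finset.filter_val]
    simpa only [eq_comm] using h1.symm
  exact ⟨Equiv.ofFiberEquiv fun c => (hc c).some, funext fun i => Equiv.ofFiberEquiv_map _ i⟩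

/-- An unordered tuple of complex numbers is determined by its monic polynomial, which separates
the points of the symmetric product. -/
lemma t2Space_symProd {f : X → ℂ} (hf : Continuous f) (hinj : Function.Injective f) :
    T2Space (SymProd X m) := by
  let F : SymProd X m → ℂ → ℂ := fun q l => SymProd.prodMap ⟨fun x => l - f x, by fun_prop⟩ q
  refine T2Space.of_injective_continuous (f := F) ?_
    (continuous_pi fun l => (SymProd.prodMap _).continuous)
  intro p q hpq
  obtain ⟨x, rfl⟩ := SymProd.mk_surjective p
  obtain ⟨y, rfl⟩ := SymProd.mk_surjective q
  have hpoly : ∏ j, (Polynomial.X - Polynomial.C (f (x j))) =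
      ∏ j, (Polynomial.X - Polynomial.C (f (y j))) := by
    refine Polynomial.funext fun l => ?_
    simpa [F, Polynomial.eval_prod] using congrFun hpq l
  have hr : ∀ z : Fin m → X, (∏ j, (Polynomial.X - Polynomial.C (f (z j)))).roots =
      Finset.univ.val.map fun j => f (z j) := fun z => by
    have := Polynomial.roots_multiset_prod_X_sub_C (Finset.univ.val.map fun j => f (z j))
    rwa [Multiset.map_map] at this
  have hroots := congrArg Polynomial.roots hpoly
  rw [hr, hr] at hroots
  obtain ⟨σ, hσ⟩ := exists_perm_of_map_eq hroots
  exact SymProd.mk_eq_mk.2 ⟨σ, funext fun j => hinj (congrFun hσ j)⟩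

/-- The map from the standard torus to the symmetric product given by `m` closed curves. -/
def torusMap (γ : Fin m → C(Circle, X)) : C(Fin m → Circle, SymProd X m) :=
  ⟨fun t => SymProd.mk fun i => γ i (t i), SymProd.continuous_mk.comp (by fun_prop)⟩

lemma torusMap_injective {γ : Fin m → C(Circle, X)} (hγ : ∀ i, Function.Injective (γ i))
    (hd : ∀ i j, i ≠ j → Disjoint (Set.range (γ i)) (Set.range (γ j))) :
    Function.Injective (torusMap γ) := by
  intro s t hst
  obtain ⟨σ, hσ⟩ := SymProd.mk_eq_mk.1 hst
  funext i
  have h1 : γ (σ i) (s (σ i)) = γ i (t i) := congrFun hσ i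
  have h2 : σ i = i := by
    by_contra hne
    exact Set.disjoint_left.1 (hd _ _ hne) ⟨_, rfl⟩ ⟨_, h1.symm⟩
  rw [h2] at h1
  exact hγ i h1

variable {γ : Fin m → C(Circle, X)} {u : Fin m → C(X, Circle)}

/-- Circle-valued functions `u i` on `X` define a map from the symmetric product to the torus. -/
def toTorus (u : Fin m → C(X, Circle)) : C(SymProd X m, Fin m → Circle) :=
  ⟨fun q i => SymProd.prodMap (u i) q, continuous_pi fun i => (SymProd.prodMap (u i)).continuous⟩

/-- If `u i ∘ γ j` has degree `δ i j` for all `i` and `j`, then `toTorus u ∘ torusMap γ` sends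
`t` to `fun i => ∏ j, t j ^ δ i j`, up to homotopy. -/
lemma toTorus_comp_torusMap_homotopic {δ : Fin m → Fin m → ℤ}
    {f : C(Fin m → Circle, Fin m → Circle)}
    (hu : ∀ i j, ∃ θ : C(Circle, ℝ), ∀ x, u i (γ j x) = x ^ δ i j * Circle.exp (θ x))
    (hf : ∀ t i, f t i = ∏ j, t j ^ δ i j) :
    ((toTorus u).comp (torusMap γ)).Homotopic f := by
  choose θ hθ using hu
  refine ContinuousMap.Homotopic.symm ⟨⟨⟨fun p i =>
    f p.2 i * Circle.exp ((p.1 : ℝ) * ∑ j, θ i j (p.2 j)), by fun_prop⟩, fun t => ?_, fun t => ?_⟩⟩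
  · funext i; simp
  · funext i
    simp only [Set.Icc.coe_one, one_mul, ContinuousMap.comp_apply]
    change f t i * _ = ∏ j, u i (γ j (t j))
    simp only [hθ, Finset.prod_mul_distrib, hf]
    congr 1
    exact map_sum Circle.expHom (fun j => θ i j (t j)) Finset.univ

end SymProd

/-! ### Formal properties of singular cohomology -/

section Cohomology

open Limits AlgebraicTopology

/-- The degree `k` cohomology of `Hom(K, ℤ)`, as a functor of the chain complex `K`. -/
def dualHomologyFunctor (k : ℕ) : (ChainComplex AddCommGrpCat.{0} ℕ)ᵒᵖ ⥤ AddCommGrpCat.{0} :=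
  HomologicalComplex.opFunctor AddCommGrpCat.{0} (ComplexShape.down ℕ) ⋙
    (preadditiveYoneda.obj (AddCommGrpCat.of ℤ)).mapHomologicalComplex
      (ComplexShape.down ℕ).symm ⋙
    HomologicalComplex.homologyFunctor AddCommGrpCat.{0} (ComplexShape.down ℕ).symm k

lemma dualHomologyFunctor_map_eq {k : ℕ} {K L : ChainComplex AddCommGrpCat.{0} ℕ} {f g : K ⟶ L}
    (h : Homotopy f g) :
    (dualHomologyFunctor k).map f.op = (dualHomologyFunctor k).map g.op :=
  ((preadditiveYoneda.obj (AddCommGrpCat.of ℤ)).mapHomotopy h.op).homologyMap_eq k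

lemma dualHomologyFunctor_map_add {k : ℕ} {K L : ChainComplex AddCommGrpCat.{0} ℕ} (f g : K ⟶ L) :
    (dualHomologyFunctor k).map (f + g).op =
      (dualHomologyFunctor k).map f.op + (dualHomologyFunctor k).map g.op := by
  unfold dualHomologyFunctor
  rw [op_add, Functor.map_add]

lemma isZero_dualHomologyFunctor_single (A : AddCommGrpCat.{0}) {k : ℕ} (hk : k ≠ 0) :
    IsZero ((dualHomologyFunctor k).obj
      (.op ((ChainComplex.single₀ AddCommGrpCat.{0}).obj A))) := by
  refine ShortComplex.isZero_homology_of_isZero_X₂ _ ?_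
  refine Functor.map_isZero (preadditiveYoneda.obj (AddCommGrpCat.of ℤ)) (IsZero.op ?_)
  exact HomologicalComplex.isZero_single_obj_X _ _ _ _ hk

/-- The integral singular chain complex. -/
abbrev chains : TopCat.{0} ⥤ ChainComplex AddCommGrpCat.{0} ℕ :=
  (singularChainComplexFunctor AddCommGrpCat.{0}).obj (AddCommGrpCat.of ℤ)

lemma isZero_cohomology_of_totallyDisconnected (X : TopCat.{0}) [TotallyDisconnectedSpace X] {k : ℕ}
    (hk : k ≠ 0) : IsZero ((cohomologyFunctor k).obj (.op X)) := by
  let e : HomotopyEquiv (chains.obj X) ((ChainComplex.single₀ AddCommGrpCat.{0}).obj _) :=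
    (HomotopyEquiv.ofIso
      (singularChainComplexFunctorIsoOfTotallyDisconnectedSpace _ (AddCommGrpCat.of ℤ) X)).trans
      (ChainComplex.alternatingConstHomotopyEquiv _)
  have h := dualHomologyFunctor_map_eq (k := k) e.homotopyHomInvId
  rw [IsZero.iff_id_eq_zero]
  change 𝟙 ((dualHomologyFunctor k).obj (.op (chains.obj X))) = 0
  rw [← CategoryTheory.Functor.map_id, ← op_id, ← h, op_comp, Functor.map_comp,
    (isZero_dualHomologyFunctor_single _ hk).eq_of_tgt ((dualHomologyFunctor k).map e.inv.op) 0,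
    zero_comp]

section Pullback

variable {k : ℕ} {X Y Z : Type} [TopologicalSpace X] [TopologicalSpace Y] [TopologicalSpace Z]

lemma cohomologyPullback_comp (g : C(Y, Z)) (f : C(X, Y)) (c : Cohomology k Z) :
    cohomologyPullback k (g.comp f) c = cohomologyPullback k f (cohomologyPullback k g c) := by
  have : (cohomologyFunctor k).map (TopCat.ofHom (g.comp f)).op =
      (cohomologyFunctor k).map (TopCat.ofHom g).op ≫
        (cohomologyFunctor k).map (TopCat.ofHom f).op := by
    rw [← Functor.map_comp]; rfl
  exact ConcreteCategory.congr_hom this c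

lemma cohomologyPullback_id (c : Cohomology k X) :
    cohomologyPullback k (ContinuousMap.id X) c = c :=
  ConcreteCategory.congr_hom ((cohomologyFunctor k).map_id (.op (TopCat.of X))) c

lemma cohomologyPullback_eq_of_homotopic {f g : C(X, Y)} (h : f.Homotopic g) :
    cohomologyPullback k f = cohomologyPullback k g := by
  obtain ⟨H⟩ := h
  let H' : TopCat.Homotopy (TopCat.ofHom f) (TopCat.ofHom g) := H
  exact congrArg AddCommGrpCat.Hom.hom (dualHomologyFunctor_map_eq (k := k)
    (H'.singularChainComplexFunctorObjMap (AddCommGrpCat.of ℤ)))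

lemma cohomologyPullback_const (hk : k ≠ 0) (y : Y) (c : Cohomology k Y) :
    cohomologyPullback k (ContinuousMap.const X y) c = 0 := by
  have h : ContinuousMap.const X y = (ContinuousMap.const Unit y).comp (.const X ()) := rfl
  have hz := isZero_cohomology_of_totallyDisconnected (TopCat.of Unit) hk
  rw [h, cohomologyPullback_comp]
  have : Subsingleton (Cohomology k Unit) := AddCommGrpCat.subsingleton_of_isZero hz
  rw [Subsingleton.elim (cohomologyPullback k (ContinuousMap.const Unit y) c) 0, map_zero]

end Pullback

/-- A map from a connected space to the disjoint union of two open subspaces factors through one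
of them. -/
lemma exists_factor_of_isOpenEmbedding {T X Y Z : Type*} [TopologicalSpace T]
    [TopologicalSpace X] [TopologicalSpace Y] [TopologicalSpace Z] [PreconnectedSpace T]
    {i : X → Z} {j : Y → Z} (hi : Topology.IsOpenEmbedding i) (hj : Topology.IsOpenEmbedding j)
    (hc : IsCompl (Set.range i) (Set.range j)) (f : C(T, Z)) :
    (∃ g : C(T, X), ∀ t, i (g t) = f t) ∨ ∃ g : C(T, Y), ∀ t, j (g t) = f t := by
  have hcl : IsClopen (f ⁻¹' Set.range i) := by
    refine ⟨⟨?_⟩, hi.isOpen_range.preimage f.continuous⟩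
    rw [← Set.preimage_compl, hc.compl_eq]
    exact hj.isOpen_range.preimage f.continuous
  rcases isClopen_iff.1 hcl with h | h
  · right
    have hr : ∀ t, f t ∈ Set.range j := fun t => by
      rw [← hc.compl_eq]
      exact fun ht => (h ▸ (show t ∈ f ⁻¹' Set.range i from ht) : t ∈ (∅ : Set T))
    choose g hg using hr
    exact ⟨⟨g, hj.isInducing.continuous_iff.2 (f.continuous.congr fun t => (hg t).symm)⟩, hg⟩
  · left
    have hr : ∀ t, f t ∈ Set.range i := fun t =>
      (h ▸ Set.mem_univ t : t ∈ f ⁻¹' Set.range i)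
    choose g hg using hr
    exact ⟨⟨g, hi.isInducing.continuous_iff.2 (f.continuous.congr fun t => (hg t).symm)⟩, hg⟩

/-- Every singular simplex of `Z` lies in exactly one of two complementary open subspaces. -/
lemma nonempty_isColimit_toSSet {X Y Z : TopCat.{0}} (i : X ⟶ Z) (j : Y ⟶ Z)
    (hi : Topology.IsOpenEmbedding i) (hj : Topology.IsOpenEmbedding j)
    (hc : IsCompl (Set.range i) (Set.range j)) (n : SimplexCategoryᵒᵖ) :
    Nonempty (IsColimit (BinaryCofan.mk ((TopCat.toSSet.map i).app n)
      ((TopCat.toSSet.map j).app n))) := by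
  rw [Types.binaryCofan_isColimit_iff]
  have hinj : ∀ {W : TopCat.{0}} (l : W ⟶ Z), Function.Injective l →
      Function.Injective ((TopCat.toSSet.map l).app n) := by
    rintro W l hl ⟨σ⟩ ⟨τ⟩ h
    have h1 : σ ≫ l = τ ≫ l := congrArg ULift.down h
    refine congrArg ULift.up (ConcreteCategory.hom_ext _ _ fun t => hl ?_)
    exact ConcreteCategory.congr_hom h1 t
  refine ⟨hinj i hi.injective, hinj j hj.injective, ?_, ?_⟩
  · rw [Set.disjoint_left]
    rintro _ ⟨⟨σ⟩, rfl⟩ ⟨⟨τ⟩, h⟩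
    change SimplexCategory.toTop.obj n.unop ⟶ X at σ
    change SimplexCategory.toTop.obj n.unop ⟶ Y at τ
    have h1 : τ ≫ j = σ ≫ i := congrArg ULift.down h
    have t : SimplexCategory.toTop.{0}.obj n.unop := Classical.arbitrary _
    have h2 : j (τ t) = i (σ t) := ConcreteCategory.congr_hom h1 t
    exact Set.disjoint_left.1 hc.disjoint ⟨σ t, rfl⟩ ⟨τ t, h2⟩
  · rw [codisjoint_iff, Set.top_eq_univ, Set.eq_univ_iff_forall]
    rintro ⟨σ⟩
    change SimplexCategory.toTop.obj n.unop ⟶ Z at σ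
    have : PreconnectedSpace (SimplexCategory.toTop.{0}.obj n.unop) := inferInstance
    rcases exists_factor_of_isOpenEmbedding hi hj hc σ.hom with ⟨g, hg⟩ | ⟨g, hg⟩
    · exact .inl ⟨⟨TopCat.ofHom g⟩, congrArg ULift.up (ConcreteCategory.hom_ext _ _ hg)⟩
    · exact .inr ⟨⟨TopCat.ofHom g⟩, congrArg ULift.up (ConcreteCategory.hom_ext _ _ hg)⟩

/-- Singular chains are additive for disjoint unions of two open subspaces. -/
lemma nonempty_isColimit_chains {X Y Z : TopCat.{0}} (i : X ⟶ Z) (j : Y ⟶ Z)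
    (hi : Topology.IsOpenEmbedding i) (hj : Topology.IsOpenEmbedding j)
    (hc : IsCompl (Set.range i) (Set.range j)) :
    Nonempty (IsColimit (BinaryCofan.mk (chains.map i) (chains.map j))) := by
  refine ⟨HomologicalComplex.isColimitOfEval _ _ fun n => ?_⟩
  refine (isColimitMapCoconeBinaryCofanEquiv _ _ _).symm ?_
  exact mapIsColimitOfPreservesOfIsColimit (sigmaConst.obj (AddCommGrpCat.of ℤ)) _ _
    (nonempty_isColimit_toSSet i j hi hj hc (.op (.mk n))).some

/-- A binary coproduct in a preadditive category is a biproduct. -/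
lemma exists_comp_add_comp_eq_id {C : Type*} [Category C] [Preadditive C] {X Y Z : C} (a : X ⟶ Z)
    (b : Y ⟶ Z) (h : IsColimit (BinaryCofan.mk a b)) :
    ∃ (r : Z ⟶ X) (s : Z ⟶ Y), r ≫ a + s ≫ b = 𝟙 Z := by
  obtain ⟨r, h1, h2⟩ : ∃ r : Z ⟶ X, a ≫ r = 𝟙 X ∧ b ≫ r = 0 :=
    ⟨_, (BinaryCofan.IsColimit.desc' h (𝟙 _) 0).2⟩
  obtain ⟨s, h3, h4⟩ : ∃ s : Z ⟶ Y, a ≫ s = 0 ∧ b ≫ s = 𝟙 Y :=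
    ⟨_, (BinaryCofan.IsColimit.desc' h 0 (𝟙 _)).2⟩
  refine ⟨r, s, BinaryCofan.IsColimit.hom_ext h ?_ ?_⟩
  · change a ≫ (r ≫ a + s ≫ b) = a ≫ 𝟙 _
    simp [reassoc_of% h1, reassoc_of% h3]
  · change b ≫ (r ≫ a + s ≫ b) = b ≫ 𝟙 _
    simp [reassoc_of% h2, reassoc_of% h4]

/-- A class that vanishes on both of two complementary open subspaces is zero. -/
lemma eq_zero_of_cohomologyPullback_eq_zero {k : ℕ} {X Y Z : Type} [TopologicalSpace X]
    [TopologicalSpace Y] [TopologicalSpace Z] (i : C(X, Z)) (j : C(Y, Z))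
    (hi : Topology.IsOpenEmbedding i) (hj : Topology.IsOpenEmbedding j)
    (hc : IsCompl (Set.range i) (Set.range j)) (c : Cohomology k Z)
    (hci : cohomologyPullback k i c = 0) (hcj : cohomologyPullback k j c = 0) : c = 0 := by
  obtain ⟨h⟩ := nonempty_isColimit_chains (TopCat.ofHom i) (TopCat.ofHom j) hi hj hc
  obtain ⟨r, s, hid⟩ := exists_comp_add_comp_eq_id _ _ h
  have key := dualHomologyFunctor_map_add (k := k) (r ≫ chains.map (TopCat.ofHom i))
    (s ≫ chains.map (TopCat.ofHom j))
  rw [hid, op_comp, op_comp, Functor.map_comp, Functor.map_comp, op_id,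
    CategoryTheory.Functor.map_id] at key
  have := ConcreteCategory.congr_hom key c
  have e1 : (dualHomologyFunctor k).map (chains.map (TopCat.ofHom i)).op c = 0 := hci
  have e2 : (dualHomologyFunctor k).map (chains.map (TopCat.ofHom j)).op c = 0 := hcj
  have e3 : c = (dualHomologyFunctor k).map r.op
        ((dualHomologyFunctor k).map (chains.map (TopCat.ofHom i)).op c) +
      (dualHomologyFunctor k).map s.op
        ((dualHomologyFunctor k).map (chains.map (TopCat.ofHom j)).op c) := this
  rw [e3, e1, e2, map_zero, map_zero, add_zero]
  rfl

end Cohomology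

/-! ### Circle-valued functions with prescribed degrees -/

/-- The circle-valued function `f / |f|` of a nonvanishing function `f`. -/
def phase {X : Type*} [TopologicalSpace X] (f : C(X, ℂ)) (h : ∀ x, f x ≠ 0) : C(X, Circle) where
  toFun x := ⟨f x / ‖f x‖, by
    rw [Submonoid.unitSphere, ← SetLike.mem_coe]
    change f x / ‖f x‖ ∈ Metric.sphere (0 : ℂ) 1
    rw [mem_sphere_zero_iff_norm, norm_div, Complex.norm_real, norm_norm,
      div_self (norm_ne_zero_iff.2 (h x))]⟩
  continuous_toFun := by
    refine Continuous.subtype_mk (Continuous.div (by fun_prop) (by fun_prop) fun x => ?_) _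
    exact_mod_cast norm_ne_zero_iff.2 (h x)

/-- If `f ∘ g` has degree `d`, then so does its phase. -/
lemma phase_eq {X : Type*} [TopologicalSpace X] (f : C(X, ℂ)) (h : ∀ x, f x ≠ 0)
    {g : C(Circle, X)} {d : ℤ} (hd : HasLog fun x : Circle => f (g x) * (x : ℂ) ^ (-d)) :
    ∃ θ : C(Circle, ℝ), ∀ x, phase f h (g x) = x ^ d * Circle.exp (θ x) := by
  obtain ⟨l, hl⟩ := hd
  refine ⟨⟨fun x => (l x).im, by fun_prop⟩, fun x => Circle.ext ?_⟩
  have h1 : f (g x) = (x : ℂ) ^ d * Complex.exp (l x) := by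
    rw [← hl, mul_left_comm, ← zpow_add₀ (Circle.coe_ne_zero x), add_neg_cancel, zpow_zero, mul_one]
  have h2 : Complex.exp (l x) = Real.exp (l x).re * Complex.exp ((l x).im * Complex.I) := by
    rw [Complex.ofReal_exp, ← Complex.exp_add, Complex.re_add_im]
  have h3 : ((Real.exp (l x).re : ℝ) : ℂ) ≠ 0 := by exact_mod_cast (Real.exp_pos _).ne'
  change f (g x) / ‖f (g x)‖ = _
  rw [h1, norm_mul, norm_zpow, Circle.norm_coe, one_zpow, one_mul, Complex.norm_exp, h2]
  simp only [Circle.coe_mul, Circle.coe_zpow, Circle.coe_exp, ContinuousMap.coe_mk]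
  field_simp

/-- The linear system for the weights `a i` of `w i` and `a' i` of `z i` is solved along the chain
`w 0, z 0, w 1, z 1, …`, starting from `a 0 = 0`. -/
lemma exists_exponents {m : ℕ} (b c : Fin m → ℤ) :
    ∃ (a : Fin (m + 1) → ℤ) (a' : Fin m → ℤ),
      ∀ i, a i.castSucc + a' i = b i ∧ a' i + a i.succ = c i := by
  let A : ℕ → ℤ := fun n => ∑ j ∈ Finset.range n, if h : j < m then c ⟨j, h⟩ - b ⟨j, h⟩ else 0
  refine ⟨fun i => A i, fun i => b i - A i, fun i => ⟨by simp, ?_⟩⟩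
  simp [A, Finset.sum_range_succ]
  ring

/-- The degree of a product in which exactly the factors `s` and `t` have degree `ε`, the others
having degree zero. -/
lemma hasLog_prod_zpow {ι X : Type*} [Fintype ι] [DecidableEq ι] [TopologicalSpace X] {s t : ι}
    (hst : s ≠ t) {F : ι → X → ℂ} {w : X → ℂ} (hw : ∀ x, w x ≠ 0) {ε : ℤ}
    (hs : HasLog fun x => F s x * w x ^ (-ε)) (ht : HasLog fun x => F t x * w x ^ (-ε))
    (hF : ∀ r, r ≠ s → r ≠ t → HasLog (F r)) (a : ι → ℤ) :
    HasLog fun x => (∏ r, F r x ^ a r) * w x ^ (-(ε * (a s + a t))) := by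
  have h1 := HasLog.prod (Finset.univ \ {s, t}) (F := fun r x => F r x ^ a r) fun r hr => by
    simp only [Finset.mem_sdiff, Finset.mem_insert, Finset.mem_singleton, not_or] at hr
    exact (hF r hr.2.1 hr.2.2).zpow _
  refine (congrArg HasLog (funext fun x => ?_)).mp (h1.mul ((hs.zpow (a s)).mul (ht.zpow (a t))))
  rw [← Finset.prod_sdiff (Finset.subset_univ {s, t}), Finset.prod_pair hst, mul_zpow, mul_zpow,
    ← zpow_mul, ← zpow_mul, show -(ε * (a s + a t)) = -ε * a s + -ε * a t by ring,
    zpow_add₀ (hw x)]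
  ring

variable {m : ℕ} (D : BridgeDiagram m)

/-- A curve that avoids the basepoints, as a curve in the punctured sphere. -/
def liftCurve (γ : C(Circle, Sphere)) (h : ∀ x, γ x ∉ Set.range D.w ∪ Set.range D.z) :
    C(Circle, D.PuncturedSphere) :=
  ⟨fun x => ⟨γ x, h x⟩, by fun_prop⟩

/-- The basepoints other than the last `z`. -/
def finitePoint : Fin (m + 1) ⊕ Fin m → Sphere := Sum.elim D.w (D.z ∘ Fin.castSucc)

lemma finitePoint_mem (s) : D.finitePoint s ∈ Set.range D.w ∪ Set.range D.z := by
  rcases s with i | i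
  · exact .inl ⟨i, rfl⟩
  · exact .inr ⟨_, rfl⟩

lemma z_ne_w (i j) : D.z i ≠ D.w j := fun h => by
  simpa using D.basepoints_injective (a₁ := .inr i) (a₂ := .inl j) h

lemma z_injective : Function.Injective D.z := fun i j h => by
  simpa using D.basepoints_injective (a₁ := .inr i) (a₂ := .inr j) h

lemma finitePoint_injective : Function.Injective D.finitePoint := by
  rintro (i | i) (j | j) h
  · simpa using D.basepoints_injective (a₁ := .inl i) (a₂ := .inl j) h
  · exact (D.z_ne_w _ _ h.symm).elim
  · exact (D.z_ne_w _ _ h).elim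
  · simpa using D.z_injective h

lemma finitePoint_ne_last (s) : D.finitePoint s ≠ D.z (Fin.last m) := by
  rcases s with i | i
  · exact fun h => D.z_ne_w _ _ h.symm
  · exact fun h => (Fin.castSucc_lt_last i).ne (D.z_injective h)

lemma not_mem_of_separates {J A B : Set Sphere} (h : Separates J A (B \ A)) {x : Sphere}
    (hx : x ∈ J) : x ∉ B := fun hB => by
  by_cases hA : x ∈ A
  · exact h.1 hA hx
  · exact h.2.1 ⟨hB, hA⟩ hx

variable {e : OpenPartialHomeomorph Sphere ℂ}

lemma punctured_ne_last (x : D.PuncturedSphere) : (x : Sphere) ≠ D.z (Fin.last m) :=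
  fun h => x.2 (.inr ⟨_, h.symm⟩)

lemma punctured_ne_finitePoint (x : D.PuncturedSphere) (s) : (x : Sphere) ≠ D.finitePoint s :=
  fun h => x.2 (by rw [h]; exact D.finitePoint_mem s)

lemma continuous_chart (hs : e.source = {D.z (Fin.last m)}ᶜ) :
    Continuous fun x : D.PuncturedSphere => e x :=
  e.continuousOn.comp_continuous continuous_subtype_val fun x => by
    rw [hs]; exact D.punctured_ne_last x

/-- The nonvanishing function `∏ (z - p) ^ a p` on the punctured sphere, in a coordinate that sends
the last basepoint to infinity. -/
def weightFunction (hs : e.source = {D.z (Fin.last m)}ᶜ) (a : Fin (m + 1) ⊕ Fin m → ℤ) :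
    C(D.PuncturedSphere, ℂ) where
  toFun x := ∏ s, (e x - e (D.finitePoint s)) ^ a s
  continuous_toFun := continuous_finsetProd _ fun s _ =>
    ((D.continuous_chart hs).sub continuous_const).zpow₀ _ fun x => .inl <| sub_ne_zero.2 <|
      chart_ne hs (D.punctured_ne_last x) (D.finitePoint_ne_last s) (D.punctured_ne_finitePoint x s)

lemma weightFunction_ne_zero (hs : e.source = {D.z (Fin.last m)}ᶜ) (a : Fin (m + 1) ⊕ Fin m → ℤ)
    (x) : D.weightFunction hs a x ≠ 0 := by
  change ∏ s, (e x - e (D.finitePoint s)) ^ a s ≠ 0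
  exact Finset.prod_ne_zero_iff.2 fun s _ => zpow_ne_zero _ <| sub_ne_zero.2 <|
      chart_ne hs (D.punctured_ne_last x) (D.finitePoint_ne_last s) (D.punctured_ne_finitePoint x s)

/-- The degree of `weightFunction a` on a curve around exactly two basepoints is, up to a sign that
only depends on the curve, the sum of the two weights. -/
lemma exists_sign (hs : e.source = {D.z (Fin.last m)}ᶜ) (ht : e.target = Set.univ)
    {γ : C(Circle, Sphere)} (hγ : Function.Injective γ) {s t : Fin (m + 1) ⊕ Fin m} (hst : s ≠ t)
    (h : Separates (Set.range γ) {D.finitePoint s, D.finitePoint t}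
      ((Set.range D.w ∪ Set.range D.z) \ {D.finitePoint s, D.finitePoint t})) :
    ∃ ε : ℤ, ε * ε = 1 ∧ ∀ a : Fin (m + 1) ⊕ Fin m → ℤ,
      ∃ θ : C(Circle, ℝ), ∀ x, phase (D.weightFunction hs a) (D.weightFunction_ne_zero hs a)
        (D.liftCurve γ (fun x => not_mem_of_separates h ⟨x, rfl⟩) x) =
          x ^ (ε * (a s + a t)) * Circle.exp (θ x) := by
  obtain ⟨ε, hε, hA, hB⟩ := exists_winding hs ht hγ h
    ⟨.inr ⟨_, rfl⟩, by simp [(D.finitePoint_ne_last _).symm]⟩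
  refine ⟨ε, hε, fun a => phase_eq _ _ ?_⟩
  refine hasLog_prod_zpow (F := fun s x => e (γ x) - e (D.finitePoint s)) hst Circle.coe_ne_zero
    (hA _ (.inl rfl)) (hA _ (.inr rfl)) (fun r hrs hrt => hB _ ⟨D.finitePoint_mem r, ?_⟩
      (D.finitePoint_ne_last r)) a
  simp [D.finitePoint_injective.eq_iff, hrs, hrt]

lemma β_not_mem (i : Fin m) (x : Circle) : D.β i x ∉ Set.range D.w ∪ Set.range D.z :=
  not_mem_of_separates (D.β_encircles i) ⟨x, rfl⟩

lemma α_not_mem (i : Fin m) (x : Circle) : D.α i x ∉ Set.range D.w ∪ Set.range D.z :=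
  not_mem_of_separates (D.α_encircles i) ⟨x, rfl⟩

/-- There are circle-valued functions on the punctured sphere with arbitrary degrees on the curves
`β j` and `α j`. -/
lemma exists_degrees (b c : Fin m → ℤ) : ∃ u : C(D.PuncturedSphere, Circle),
    (∀ j, ∃ θ : C(Circle, ℝ), ∀ x, u (D.liftCurve (D.β j) (D.β_not_mem j) x) =
      x ^ b j * Circle.exp (θ x)) ∧
    ∀ j, ∃ θ : C(Circle, ℝ), ∀ x, u (D.liftCurve (D.α j) (D.α_not_mem j) x) =
      x ^ c j * Circle.exp (θ x) := by
  obtain ⟨e, hs, ht⟩ := exists_stereographic_chart (D.z (Fin.last m))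
  choose ε hε hβ using fun i => D.exists_sign hs ht (D.β_injective i)
    (s := .inl i.castSucc) (t := .inr i) (by simp) (D.β_encircles i)
  choose η hη hα using fun i => D.exists_sign hs ht (D.α_injective i)
    (s := .inr i) (t := .inl i.succ) (by simp) (D.α_encircles i)
  obtain ⟨a, a', ha⟩ := exists_exponents (fun i => ε i * b i) (fun i => η i * c i)
  refine ⟨phase _ (D.weightFunction_ne_zero hs (Sum.elim a a')), fun j => ?_, fun j => ?_⟩
  · obtain ⟨θ, hθ⟩ := hβ j (Sum.elim a a')
    refine ⟨θ, fun x => (hθ x).trans ?_⟩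
    rw [Sum.elim_inl, Sum.elim_inr, (ha j).1, ← mul_assoc, hε, one_mul]
  · obtain ⟨θ, hθ⟩ := hα j (Sum.elim a a')
    refine ⟨θ, fun x => (hθ x).trans ?_⟩
    rw [Sum.elim_inl, Sum.elim_inr, (ha j).2, ← mul_assoc, hη, one_mul]

/-! ### Extending classes from the tori -/

instance : T2Space (SymProd D.PuncturedSphere m) := by
  obtain ⟨e, hs, -⟩ := exists_stereographic_chart (D.z (Fin.last m))
  refine t2Space_symProd (D.continuous_chart hs) fun x y hxy => Subtype.ext ?_
  by_contra hne
  exact chart_ne hs (D.punctured_ne_last x) (D.punctured_ne_last y) hne hxy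

variable {γ δ : Fin m → C(Circle, Sphere)}

/-- The parametrization of `torus γ` by the standard torus. -/
def torusHomeomorph (hγ : ∀ i, Function.Injective (γ i))
    (hd : ∀ i j, i ≠ j → Disjoint (Set.range (γ i)) (Set.range (γ j)))
    (h : ∀ i x, γ i x ∉ Set.range D.w ∪ Set.range D.z) : (Fin m → Circle) ≃ₜ D.torus γ := by
  let f : (Fin m → Circle) → D.torus γ := fun t =>
    ⟨torusMap (fun i => D.liftCurve (γ i) (h i)) t, _, fun i => ⟨t i, rfl⟩, rfl⟩
  have hf : Continuous f := (ContinuousMap.continuous _).subtype_mk _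
  refine Continuous.homeoOfEquivCompactToT2 (f := Equiv.ofBijective f ⟨?_, ?_⟩) hf
  · refine fun s t hst => torusMap_injective (γ := fun i => D.liftCurve (γ i) (h i))
      (fun i x y hxy => hγ i (congrArg Subtype.val hxy)) (fun i j hij => ?_)
      (congrArg Subtype.val hst)
    rw [Set.disjoint_left]
    rintro _ ⟨x, rfl⟩ ⟨y, hy⟩
    exact Set.disjoint_left.1 (hd i j hij) ⟨x, rfl⟩ ⟨y, congrArg Subtype.val hy⟩
  · rintro ⟨_, x, hx, rfl⟩
    choose t ht using id hx
    exact ⟨t, Subtype.ext (congrArg SymProd.mk (funext fun i => Subtype.ext (ht i)))⟩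

/-- The inclusion of `torus γ` in the symmetric product. -/
def torusInclusion (γ : Fin m → C(Circle, Sphere)) :
    C(D.torus γ, SymProd D.PuncturedSphere m) := ⟨Subtype.val, continuous_subtype_val⟩

/-- If there are circle-valued functions `u i` whose degrees on the curves `γ j` form the identity
matrix and vanish on the curves `δ j`, then every class on `torus γ` extends to a class on the
symmetric product that vanishes on `torus δ`. -/
lemma exists_extension {k : ℕ} (hk : k ≠ 0)
    (hγ : ∀ i, Function.Injective (γ i))
    (hγd : ∀ i j, i ≠ j → Disjoint (Set.range (γ i)) (Set.range (γ j)))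
    (hγm : ∀ i x, γ i x ∉ Set.range D.w ∪ Set.range D.z)
    (hδ : ∀ i, Function.Injective (δ i))
    (hδd : ∀ i j, i ≠ j → Disjoint (Set.range (δ i)) (Set.range (δ j)))
    (hδm : ∀ i x, δ i x ∉ Set.range D.w ∪ Set.range D.z)
    {u : Fin m → C(D.PuncturedSphere, Circle)}
    (huγ : ∀ i j, ∃ θ : C(Circle, ℝ), ∀ x, u i (D.liftCurve (γ j) (hγm j) x) =
      x ^ (if i = j then 1 else 0 : ℤ) * Circle.exp (θ x))
    (huδ : ∀ i j, ∃ θ : C(Circle, ℝ), ∀ x, u i (D.liftCurve (δ j) (hδm j) x) =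
      x ^ (0 : ℤ) * Circle.exp (θ x))
    (c : Cohomology k (D.torus γ)) :
    ∃ d : Cohomology k (SymProd D.PuncturedSphere m),
      cohomologyPullback k (D.torusInclusion γ) d = c ∧
        cohomologyPullback k (D.torusInclusion δ) d = 0 := by
  let τ := D.torusHomeomorph hγ hγd hγm
  let σ := D.torusHomeomorph hδ hδd hδm
  have h1 : ((toTorus u).comp ((D.torusInclusion γ).comp (τ : C(_, _)))).Homotopic (.id _) :=
    toTorus_comp_torusMap_homotopic huγ fun t i => by simp
  have h2 : ((toTorus u).comp ((D.torusInclusion δ).comp (σ : C(_, _)))).Homotopic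
      (.const (Fin m → Circle) 1) :=
    toTorus_comp_torusMap_homotopic (δ := fun _ _ => 0) huδ fun t i => by simp
  have hinj : ∀ {Y : Type} [TopologicalSpace Y] (ρ : (Fin m → Circle) ≃ₜ Y) (x y : Cohomology k Y),
      cohomologyPullback k (ρ : C(Fin m → Circle, Y)) x =
        cohomologyPullback k (ρ : C(Fin m → Circle, Y)) y → x = y := by
    intro Y _ ρ x y hxy
    have := congrArg (cohomologyPullback k (ρ.symm : C(Y, Fin m → Circle))) hxy
    rw [← cohomologyPullback_comp, ← cohomologyPullback_comp] at this
    have hid : (ρ : C(Fin m → Circle, Y)).comp (ρ.symm : C(Y, Fin m → Circle)) = .id Y := by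
      ext; simp
    rwa [hid, cohomologyPullback_id, cohomologyPullback_id] at this
  refine ⟨cohomologyPullback k (toTorus u) (cohomologyPullback k (τ : C(_, _)) c), hinj τ _ _ ?_,
    hinj σ _ _ ?_⟩
  · rw [← cohomologyPullback_comp, ← cohomologyPullback_comp,
      cohomologyPullback_eq_of_homotopic h1, cohomologyPullback_id]
  · rw [← cohomologyPullback_comp, ← cohomologyPullback_comp,
      cohomologyPullback_eq_of_homotopic h2, cohomologyPullback_const hk, map_zero]

/-- The inclusion of `torus β` at the bottom end. -/
def bottomInclusion : C(D.torus D.β, D.ends) :=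
  ⟨fun q => ⟨(q, 0), .inl ⟨q.2, rfl⟩⟩, by fun_prop⟩

/-- The inclusion of `torus α` at the top end. -/
def topInclusion : C(D.torus D.α, D.ends) :=
  ⟨fun q => ⟨(q, 1), .inr ⟨q.2, rfl⟩⟩, by fun_prop⟩

lemma mem_range_bottomInclusion (x : D.ends) :
    x ∈ Set.range D.bottomInclusion ↔ x.1.2 = 0 := by
  obtain ⟨⟨q, t⟩, hx⟩ := x
  constructor
  · rintro ⟨p, hp⟩
    exact (congrArg (fun x : D.ends => x.1.2) hp).symm
  · rintro rfl
    rcases hx with ⟨hq, -⟩ | ⟨-, h⟩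
    · exact ⟨⟨q, hq⟩, rfl⟩
    · exact (zero_ne_one h).elim

lemma mem_range_topInclusion (x : D.ends) :
    x ∈ Set.range D.topInclusion ↔ x.1.2 = 1 := by
  obtain ⟨⟨q, t⟩, hx⟩ := x
  constructor
  · rintro ⟨p, hp⟩
    exact (congrArg (fun x : D.ends => x.1.2) hp).symm
  · rintro rfl
    rcases hx with ⟨-, h⟩ | ⟨hq, -⟩
    · exact (one_ne_zero h).elim
    · exact ⟨⟨q, hq⟩, rfl⟩

lemma isCompl_range : IsCompl (Set.range D.bottomInclusion) (Set.range D.topInclusion) := by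
  have h : Set.range D.topInclusion = (Set.range D.bottomInclusion)ᶜ := by
    ext x
    rw [Set.mem_compl_iff, mem_range_topInclusion, mem_range_bottomInclusion]
    refine ⟨fun h h' => zero_ne_one (h'.symm.trans h), fun h => ?_⟩
    rcases x.2 with h' | h'
    · exact (h h'.2).elim
    · exact h'.2
  rw [h]
  exact isCompl_compl

/-- Each end is closed, and hence, as the complement of the other one, also open. -/
lemma isOpen_range :
    IsOpen (Set.range D.bottomInclusion) ∧ IsOpen (Set.range D.topInclusion) := by
  have hcont : Continuous fun x : D.ends => x.1.2 :=
    continuous_snd.comp continuous_subtype_val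
  constructor
  · rw [← D.isCompl_range.symm.compl_eq]
    rw [isOpen_compl_iff, show Set.range D.topInclusion = _ from Set.ext D.mem_range_topInclusion]
    exact isClosed_singleton.preimage hcont
  · rw [← D.isCompl_range.compl_eq]
    rw [isOpen_compl_iff,
      show Set.range D.bottomInclusion = _ from Set.ext D.mem_range_bottomInclusion]
    exact isClosed_singleton.preimage hcont

/-- The projection of the ends to the symmetric product. -/
def endsProjection : C(D.ends, SymProd D.PuncturedSphere m) :=
  ⟨fun x => x.1.1, by fun_prop⟩

lemma isOpenEmbedding_bottomInclusion : Topology.IsOpenEmbedding D.bottomInclusion :=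
  ⟨.of_comp D.bottomInclusion.continuous D.endsProjection.continuous .subtypeVal, D.isOpen_range.1⟩

lemma isOpenEmbedding_topInclusion : Topology.IsOpenEmbedding D.topInclusion :=
  ⟨.of_comp D.topInclusion.continuous D.endsProjection.continuous .subtypeVal, D.isOpen_range.2⟩

end BridgeDiagram

open BridgeDiagram in
theorem proposition5 (m : ℕ) (D : BridgeDiagram m) (k : ℕ) (hk : 1 ≤ k) :
    Function.Surjective (BridgeDiagram.cohomologyPullback k D.endsInclusion) := by
  intro c
  have hk0 : k ≠ 0 := by omega
  -- `u` detects the `β`-curves and not the `α`-curves, `v` the other way round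
  choose u huβ huα using fun i => D.exists_degrees (fun j => if i = j then 1 else 0) fun _ => 0
  choose v hvβ hvα using fun i => D.exists_degrees (fun _ => 0) fun j => if i = j then 1 else 0
  obtain ⟨d₀, hd₀β, hd₀α⟩ := D.exists_extension hk0 D.β_injective D.β_disjoint D.β_not_mem
    D.α_injective D.α_disjoint D.α_not_mem huβ huα (cohomologyPullback k D.bottomInclusion c)
  obtain ⟨d₁, hd₁α, hd₁β⟩ := D.exists_extension hk0 D.α_injective D.α_disjoint D.α_not_mem
    D.β_injective D.β_disjoint D.β_not_mem hvα hvβ (cohomologyPullback k D.topInclusion c)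
  let pr : C(SymProd D.PuncturedSphere m × unitInterval, SymProd D.PuncturedSphere m) := .fst
  refine ⟨cohomologyPullback k pr (d₀ + d₁), sub_eq_zero.1 ?_⟩
  refine eq_zero_of_cohomologyPullback_eq_zero D.bottomInclusion D.topInclusion
    D.isOpenEmbedding_bottomInclusion D.isOpenEmbedding_topInclusion D.isCompl_range _ ?_ ?_
  · rw [map_sub, ← cohomologyPullback_comp, ← cohomologyPullback_comp]
    change cohomologyPullback k (D.torusInclusion D.β) (d₀ + d₁) - _ = 0
    rw [map_add, hd₀β, hd₁β, add_zero, sub_self]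
  · rw [map_sub, ← cohomologyPullback_comp, ← cohomologyPullback_comp]
    change cohomologyPullback k (D.torusInclusion D.α) (d₀ + d₁) - _ = 0
    rw [map_add, hd₀α, hd₁α, zero_add, sub_self]

end
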